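/- Let $I=[0,1]$ and let $m$ be Lebesgue measure on $I$. **Norms.** For finite measures $\mu,\nu$ on $I$ let $W_1^0(\mu,\nu)=\|\mu-\nu\|_W=\sup\{|\int g\,d\mu-\int g\,d\nu| : \mathrm{Lip}(g)\le 1,\ \|g\|_\infty\le 1\}$. Let $\mathcal{AB}$ be the set of signed Borel measures $\nu$ on $I^2$ such that the marginals of $\nu^+$ and $\nu^-$ on the first coordinate are absolutely continuous with respect to $m$. A positive $\mu\in\mathcal{AB}$ has a disintegration $(\{\mu_\gamma\},\phi)$: $\phi\ge 0$ is its marginal density, the $\mu_\gamma$ are probabilities on the leaves $\{\gamma\}\times I\cong I$, and $\mu(E)=\int \mu_\gamma(E\cap\gamma)\,\phi(\gamma)\,dm(\gamma)$; put $\mu|_\gamma=\phi(\gamma)\mu_\gamma$. For $\nu\in\mathcal{AB}$ let $\|\nu\|_1=\int_I W_1^0(\nu^+|_\gamma,\nu^-|_\gamma)\,dm(\gamma)$ and $\|\nu\|_\infty=\operatorname{ess\,sup}_\gamma W_1^0(\nu^+|_\gamma,\nu^-|_\gamma)$, let $\phi_\nu=\phi_{\nu^+}-\phi_{\nu^-}$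 be its marginal density, and let $\mathcal L^1$ be the set of $\nu\in\mathcal{AB}$ with $\|\nu\|_1<\infty$. The variation $\mathrm{Var}(\mu)$ of a positive measure $\mu \in \mathcal{AB}$ is the infimum, over all disintegrations of $\mu$ and all sets $D\subseteq I$ of full measure, of $\sup\sum_{j}\|\mu|_{x_{j+1}}-\mu|_{x_{j}}\|_W$, the supremum being over finite increasing sequences $(x_j)$ in $D$. Fix $A_1>0$. For $h\in L^1(m)$ let $\mathrm{var}_{1,1}(h)=\sup_{0<\epsilon\le A_1}\frac1\epsilon\int_I \operatorname{ess\,sup}_{y_1,y_2\in B_\epsilon(x)}|h(y_1)-h(y_2)|\,dm(x)$ and $|h|_{1,1}=\mathrm{var}_{1,1}(h)+|h|_1$; $BV_{1,1}$ is the space of $h$ with $|h|_{1,1}<\infty$, and $\mathcal{BV}^\infty_{1,1}$ is the set of $\nu\in\mathcal{AB}$ with $\|\nu\|_\infty<\infty$ and $\phi_\nu\in BV_{1,1}$. **Maps.** A measurable map $F(x,y)=(T(x),G(x,y))$ of $I^2$ into itself is a *BV Lorenz-like map* if: 1. there are $H\ge0$ and a partition $0=b_0<\dots<b_d=1$ with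 $|G(x_1,y)-G(x_2,y)|\le H|x_1-x_2|$ for all $y\in I$ and all $x_1,x_2$ in the same interval $(b_{i-1},b_i)$; 2. there is $0<\alpha<1$ with $|G(x,y_1)-G(x,y_2)|\le\alpha|y_1-y_2|$ for all $x,y_1,y_2\in I$; 3. there is a partition $0=a_0<\dots<a_q=1$ such that on each $P_i=(a_{i-1},a_i)$ the map $T$ is $C^1$ with $T'\neq0$ and $1/|T'|$ of bounded variation, and there are $n_0\in\mathbb N$ and $\lambda_1>1$ with $|(T^{n_0})'(x)|\ge\lambda_1$ at all $x$ with $x,T(x),\dots,T^{n_0-1}(x)\in\bigcup_i P_i$; 4. the Perron–Frobenius operator $P_T$ has a unique fixed probability density $\psi_0$ in $BV_{1,1}$, and $|P_T^k(\psi_0-\psi)|_{1,1}\to0$ as $k\to\infty$ for every probability density $\psi\in BV_{1,1}$. The transfer operator of $F$ is $(F^*\nu)(E)=\nu(F^{-1}(E))$ on signed Borel measures on $I^2$. For $T_1,T_2:I\to I$ the Skorokhod distance $d_S(T_1,T_2)$ is the infimum of the $\epsilon$ for which there are a measurable $A\subseteq I$ with $m(A)\ge1-\epsilon$ and a $C^1$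 diffeomorphism $\sigma$ of $I$ with $T_1=T_2\circ\sigma$, $|\sigma(x)-x|\le\epsilon$ and $|1/\sigma'(x)-1|\le\epsilon$ for all $x \in A$. **Proposition.** Let $F_\delta=(T_\delta,G_\delta)$, $\delta\in[0,1)$, be a family of BV Lorenz-like maps such that for all sufficiently small $\delta$ * $d_S(T_0,T_\delta)\le\delta$, and * there is a measurable $A_2\subseteq I$ with $m(A_2)\ge1-\delta$ and $|G_0(x,y)-G_\delta(x,y)|\le\delta$ for all $x\in A_2$, $y\in I$. Then there are $C_1>0$ and $\delta_1\in(0,1]$, depending only on the family $\{F_\delta\}$, such that the following holds. If for every $\delta\in[0,1)$ the probability measure $f_\delta\in\mathcal{BV}^\infty_{1,1}$ is a fixed point of $F_\delta^*$, and $\mathrm{Var}(f_\delta)\le M_2$ for all $\delta\in[0,1)$, where $0\le M_2<\infty$, then for all $\delta\in[0,\delta_1)$ $$(F_0^*-F_\delta^*)f_\delta\in\mathcal L^1\quad\text{and}\quad \|(F_0^*-F_\delta^*)f_\delta\|_1\le C_1\,\delta\,(M_2+1).$$ -/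

import Mathlib

open MeasureTheory ProbabilityTheory Set Filter Topology
open scoped NNReal ENNReal unitInterval

noncomputable section

namespace LorenzStability

/-! ### Measures on the fibres -/

/-- The Wasserstein–Kantorovich-like distance `W₁⁰` of two (finite) measures on `I`: the supremum of
`|∫ g dμ - ∫ g dν|` over all `g` with `Lip(g) ≤ 1` and `‖g‖_∞ ≤ 1`. For `μ`, `ν` finite it is
`‖μ - ν‖_W`. -/
def wDist (μ ν : Measure I) : ℝ≥0∞ :=
  ⨆ g ∈ {g : I → ℝ | LipschitzWith 1 g ∧ ∀ y, |g y| ≤ 1},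
    ENNReal.ofReal |∫ y, g y ∂μ - ∫ y, g y ∂ν|

/-- The marginal density `φ_x` of a positive measure on the square whose first marginal is
absolutely continuous. -/
def density (μ : Measure (I × I)) (γ : I) : ℝ≥0 :=
  (μ.fst.rnDeriv volume γ).toNNReal

/-- The restriction `μ|_γ = φ_x(γ) μ_γ` of a positive measure to the leaf `{γ} × I ≅ I`, where
`μ_γ` are the conditional probabilities of the disintegration along the vertical leaves. -/
def fibreMeasure (μ : Measure (I × I)) [IsFiniteMeasure μ] (γ : I) : Measure I :=
  density μ γ • μ.condKernel γ

/-! ### Spaces of signed measures on the square -/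

/-- The positive part `ν⁺` of a signed measure (Jordan decomposition). -/
abbrev pos (ν : SignedMeasure (I × I)) : Measure (I × I) := ν.toJordanDecomposition.posPart

/-- The negative part `ν⁻` of a signed measure (Jordan decomposition). -/
abbrev neg (ν : SignedMeasure (I × I)) : Measure (I × I) := ν.toJordanDecomposition.negPart

/-- The class `𝓐𝓑`: signed measures such that the first marginals of `ν⁺` and `ν⁻` are absolutely
continuous with respect to Lebesgue measure. -/
def IsAB (ν : SignedMeasure (I × I)) : Prop :=
  (pos ν).fst ≪ volume ∧ (neg ν).fst ≪ volume

/-- `‖ν‖₁ = ∫ W₁⁰(ν⁺|_γ, ν⁻|_γ) dm(γ)`. -/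
def norm1 (ν : SignedMeasure (I × I)) : ℝ≥0∞ :=
  ∫⁻ γ, wDist (fibreMeasure (pos ν) γ) (fibreMeasure (neg ν) γ)

/-- `‖ν‖_∞ = ess sup W₁⁰(ν⁺|_γ, ν⁻|_γ)`. -/
def normInf (ν : SignedMeasure (I × I)) : ℝ≥0∞ :=
  essSup (fun γ => wDist (fibreMeasure (pos ν) γ) (fibreMeasure (neg ν) γ)) volume

/-- The space `𝓛¹`. -/
def IsL1 (ν : SignedMeasure (I × I)) : Prop := IsAB ν ∧ norm1 ν < ∞

/-- The space `𝓛^∞`. -/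
def IsLInf (ν : SignedMeasure (I × I)) : Prop := IsAB ν ∧ normInf ν < ∞

/-- The marginal density `φ_x = φ_x⁺ - φ_x⁻` of a signed measure in `𝓐𝓑`. -/
def signedDensity (ν : SignedMeasure (I × I)) (γ : I) : ℝ :=
  (density (pos ν) γ : ℝ) - (density (neg ν) γ : ℝ)

/-! ### Generalized bounded variation on the interval -/

/-- `osc(h, B_ε(x))`: the essential supremum (for `m ⊗ m`) of `|h(y₁) - h(y₂)|` over
`y₁, y₂ ∈ B_ε(x)`. -/
def osc (h : I → ℝ) (ε : ℝ) (x : I) : ℝ≥0∞ :=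
  essSup (fun p : I × I => ENNReal.ofReal |h p.1 - h p.2|)
    ((volume.restrict (Metric.ball x ε)).prod (volume.restrict (Metric.ball x ε)))

/-- `osc₁(h, ε) = ∫ osc(h, B_ε(x)) dm(x)`. -/
def osc1 (h : I → ℝ) (ε : ℝ) : ℝ≥0∞ := ∫⁻ x, osc h ε x

/-- `var_{1,1}(h) = sup_{0 < ε ≤ A₁} osc₁(h, ε) / ε`. -/
def var11 (A₁ : ℝ) (h : I → ℝ) : ℝ≥0∞ :=
  ⨆ ε ∈ Ioc (0 : ℝ) A₁, osc1 h ε / ENNReal.ofReal ε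

/-- The norm `|h|_{1,1} = var_{1,1}(h) + |h|₁`. -/
def norm11 (A₁ : ℝ) (h : I → ℝ) : ℝ≥0∞ := var11 A₁ h + eLpNorm h 1 volume

/-- Membership in the (real) space `BV_{1,1}`. -/
def IsBV11 (A₁ : ℝ) (h : I → ℝ) : Prop := Integrable h volume ∧ var11 A₁ h < ∞

/-- The space `𝓑𝓥_{1,1}^∞`: the signed measures in `𝓛^∞` with marginal density in `BV_{1,1}`. -/
def IsBVInf11 (A₁ : ℝ) (ν : SignedMeasure (I × I)) : Prop :=
  IsLInf ν ∧ IsBV11 A₁ (signedDensity ν)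

/-! ### Variation of a positive measure along the vertical leaves -/

/-- The variation of a path of measures `Γ`, defined on `D ⊆ I`: the supremum over finite
monotone sequences in `D` of the sum of the `‖·‖_W`-distances of consecutive values. -/
def pathVar (Γ : I → Measure I) (D : Set I) : ℝ≥0∞ :=
  ⨆ (n : ℕ) (u : ℕ → I) (_ : Monotone u ∧ ∀ i, u i ∈ D),
    ∑ i ∈ Finset.range n, wDist (Γ (u (i + 1))) (Γ (u i))

/-- `(κ, φ)` is a disintegration of `μ` along the vertical leaves: `φ` is a density of the first
marginal, `κ γ` are probabilities, and `μ(E) = ∫ κ_γ(E ∩ γ) φ(γ) dm(γ)`. -/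
def IsDisintegration (μ : Measure (I × I)) (κ : Kernel I I) (φ : I → ℝ≥0) : Prop :=
  IsMarkovKernel κ ∧ Measurable φ ∧
    μ = (volume.withDensity fun γ => (φ γ : ℝ≥0∞)) ⊗ₘ κ

/-- `Var(μ)`: the infimum, over all disintegrations of `μ` and all sets `D` of full Lebesgue measure
(on which the path `γ ↦ μ|_γ = φ(γ) μ_γ` is regarded as defined), of the variation of the path. -/
def measureVar (μ : Measure (I × I)) : ℝ≥0∞ :=
  ⨅ (κ : Kernel I I) (φ : I → ℝ≥0) (D : Set I)
    (_ : IsDisintegration μ κ φ ∧ ∀ᵐ γ : I, γ ∈ D), pathVar (fun γ => φ γ • κ γ) D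

/-! ### Maps -/

/-- A self-map of `I`, extended to the real line by constants. Inside `(0,1)` the extension has the
same derivatives as the map, and on `[0,1]` the same one-sided derivatives. -/
def lineExt (h : I → I) (x : ℝ) : ℝ := (h (projIcc 0 1 zero_le_one x) : ℝ)

/-- A partition of `[0,1]` into `q` consecutive intervals, given by its end points
`0 = a₀ < a₁ < ⋯ < a_q = 1`. -/
structure IsPartition (q : ℕ) (a : Fin (q + 1) → ℝ) : Prop where
  strictMono : StrictMono a
  first : a 0 = 0
  last : a (Fin.last q) = 1

/-- The `i`-th open interval of a partition. -/
def cell {q : ℕ} (a : Fin (q + 1) → ℝ) (i : Fin q) : Set ℝ := Ioo (a i.castSucc) (a i.succ)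

/-- The Perron–Frobenius operator of a nonsingular map `T` of `I`: the density, with respect to
Lebesgue measure, of the image under `T` of the signed measure `φ m`. -/
def perronFrobenius (T : I → I) (φ : I → ℝ) : I → ℝ :=
  SignedMeasure.rnDeriv ((volume.withDensityᵥ φ).map T) volume

/-- `ψ ∈ BV_{1,1}` is the density of a probability measure. -/
def IsDensity (A₁ : ℝ) (ψ : I → ℝ) : Prop :=
  IsBV11 A₁ ψ ∧ 0 ≤ᵐ[volume] ψ ∧ ∫ x, ψ x = 1

/-- `T` has a unique invariant probability density `ψ₀` in `BV_{1,1}`, and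
`P_T^k (ψ₀ - ψ) → 0` in `BV_{1,1}` for all probability densities `ψ ∈ BV_{1,1}`. -/
def IsIndecomposable (A₁ : ℝ) (T : I → I) : Prop :=
  ∃ ψ₀ : I → ℝ, IsDensity A₁ ψ₀ ∧ perronFrobenius T ψ₀ =ᵐ[volume] ψ₀ ∧
    (∀ ψ : I → ℝ, IsDensity A₁ ψ → perronFrobenius T ψ =ᵐ[volume] ψ → ψ =ᵐ[volume] ψ₀) ∧
    ∀ ψ : I → ℝ, IsDensity A₁ ψ →
      Tendsto (fun k : ℕ => norm11 A₁ ((perronFrobenius T)^[k] (ψ₀ - ψ))) atTop (𝓝 0)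

/-- Piecewise expanding maps of the interval with bounded variation inverse of the derivative. -/
def IsPiecewiseExpandingBV (A₁ : ℝ) (T : I → I) : Prop :=
  (∃ (q : ℕ) (a : Fin (q + 1) → ℝ), IsPartition q a ∧
    (∀ i, ContDiffOn ℝ 1 (lineExt T) (cell a i)) ∧
    (∀ i, ∀ x ∈ cell a i, deriv (lineExt T) x ≠ 0) ∧
    (∀ i, BoundedVariationOn (fun x => 1 / |deriv (lineExt T) x|) (cell a i)) ∧
    ∃ (n₀ : ℕ) (lam : ℝ), 1 < lam ∧
      ∀ x : I, (∀ j < n₀, ∃ i, ((T^[j] x : I) : ℝ) ∈ cell a i) →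
        lam ≤ |deriv (lineExt (T^[n₀])) x|) ∧
  IsIndecomposable A₁ T

/-- A measurable skew product `F(x,y) = (T(x), G(x,y))` of the unit square. -/
structure SkewProduct where
  T : I → I
  G : I → I → I
  measurable_T : Measurable T
  measurable_G : Measurable (Function.uncurry G)

/-- The map `F(x,y) = (T(x), G(x,y))`. -/
def SkewProduct.map (F : SkewProduct) (p : I × I) : I × I := (F.T p.1, F.G p.1 p.2)

lemma SkewProduct.measurable_map (F : SkewProduct) : Measurable F.map :=
  (F.measurable_T.comp measurable_fst).prodMk F.measurable_G

/-- The transfer operator `(F^* ν)(E) = ν(F⁻¹(E))` on signed measures. -/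
def SkewProduct.transfer (F : SkewProduct) (ν : SignedMeasure (I × I)) : SignedMeasure (I × I) :=
  ν.map F.map

lemma SkewProduct.transfer_apply (F : SkewProduct) (ν : SignedMeasure (I × I)) {E : Set (I × I)}
    (hE : MeasurableSet E) : F.transfer ν E = ν (F.map ⁻¹' E) :=
  VectorMeasure.map_apply ν F.measurable_map hE

/-- BV Lorenz-like maps. -/
structure IsBVLorenzLike (A₁ : ℝ) (F : SkewProduct) : Prop where
  lipschitz : ∃ (H : ℝ) (d : ℕ) (b : Fin (d + 1) → ℝ), 0 ≤ H ∧ IsPartition d b ∧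
    ∀ i, ∀ x₁ x₂ y : I, (x₁ : ℝ) ∈ cell b i → (x₂ : ℝ) ∈ cell b i →
      |(F.G x₁ y : ℝ) - F.G x₂ y| ≤ H * |(x₁ : ℝ) - x₂|
  contracting : ∃ α ∈ Ioo (0 : ℝ) 1, ∀ x y₁ y₂ : I,
    |(F.G x y₁ : ℝ) - F.G x y₂| ≤ α * |(y₁ : ℝ) - y₂|
  expanding : IsPiecewiseExpandingBV A₁ F.T

/-! ### Closeness of maps -/

/-- `s` is a (`C¹`) diffeomorphism of `[0,1]`. -/
def IsDiffeo (s : I ≃ I) : Prop :=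
  ContDiffOn ℝ 1 (lineExt s) (Icc 0 1) ∧ ContDiffOn ℝ 1 (lineExt s.symm) (Icc 0 1)

/-- The set `𝓒(T₁, T₂)` in the definition of the Skorokhod distance. -/
def skorokhodSet (T₁ T₂ : I → I) : Set ℝ :=
  {ε | ∃ (A : Set I) (s : I ≃ I), MeasurableSet A ∧ IsDiffeo s ∧ 1 - ε ≤ volume.real A ∧
    ∀ x ∈ A, T₁ x = T₂ (s x) ∧ |(s x : ℝ) - x| ≤ ε ∧
      |1 / derivWithin (lineExt s) (Icc 0 1) x - 1| ≤ ε}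

/-- The Skorokhod distance `d_S(T₁, T₂)`. -/
def skorokhodDist (T₁ T₂ : I → I) : ℝ := sInf (skorokhodSet T₁ T₂)

/-- Closeness of the base maps: `d_S(T₀, T_δ) ≤ δ` for all small `δ`. -/
def UBV2 (F : ℝ → SkewProduct) : Prop :=
  ∃ δ₀ ∈ Ioc (0 : ℝ) 1, ∀ δ ∈ Ico (0 : ℝ) δ₀, skorokhodDist (F 0).T (F δ).T ≤ δ

/-- Closeness of the fibre maps: for all small `δ`, `|G₀ - G_δ| ≤ δ` over a set of measure at least
`1 - δ`. -/
def UBV3 (F : ℝ → SkewProduct) : Prop :=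
  ∃ δ₀ ∈ Ioc (0 : ℝ) 1, ∀ δ ∈ Ico (0 : ℝ) δ₀,
    ∃ A : Set I, MeasurableSet A ∧ 1 - δ ≤ volume.real A ∧
      ∀ x ∈ A, ∀ y : I, |((F 0).G x y : ℝ) - (F δ).G x y| ≤ δ

end LorenzStability

end

namespace LorenzStability

/-! ### Positive and negative parts of a difference of measures -/

section JordanSub

variable {μ ν : Measure (I × I)} [IsFiniteMeasure μ] [IsFiniteMeasure ν]

/-! The norm `norm1` is dual to functions `h` on the square that are measurable, bounded by 1 and
1-Lipschitz along leaves (`lintegral_wDist_le`): countably many functions on `I` compute `wDist`,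
and finitely many of them can be selected leaf by leaf in a measurable way. It therefore suffices to
bound `∫ h ∘ F₀ dμ - ∫ h ∘ F_δ dμ` with `μ = f_δ`.

Disintegrate `μ` and let `k_F(x)` be the integral of `y ↦ h(F(x,y))` against `μ|_x`. The value
`k_{F₀}(x)` is compared with `k_{F_δ}(σ x)`, where `σ` is a nearly optimal Skorokhod diffeomorphism.
As `T₀ x = T_δ (σ x)`, both image points lie on one leaf, where `h` is 1-Lipschitz
(`fibre_comparison`). Moving the map costs `Hε + δ` times the density. Moving the measure costs the
Wasserstein distance of `μ|_x` and `μ|_{σ x}`, at most `V(x+ε) - V(x-ε)` for a monotone `V` with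
values in `[0, M]`; this integrates to at most `2εM` (`integral_monotone_shift_sub_le`).

Undoing `σ` costs `O(ε)`, since its Jacobian is close to 1 (`setIntegral_comp_sub_integral_le`). The
exceptional base points have measure `O(δ)`, and there the integrands are controlled by the density,
which is at most `M + 1` (`density_le`). `integral_test_sub_le` adds up these losses. -/

lemma pos_sub : pos (μ.toSignedMeasure - ν.toSignedMeasure) = μ - ν := by
  rw [pos, Measure.toJordanDecomposition_toSignedMeasure_sub,
    Measure.jordanDecompositionOfToSignedMeasureSub_posPart]

lemma neg_sub : neg (μ.toSignedMeasure - ν.toSignedMeasure) = ν - μ := by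
  rw [neg, Measure.toJordanDecomposition_toSignedMeasure_sub,
    Measure.jordanDecompositionOfToSignedMeasureSub_negPart]

lemma sub_add_eq_sub_add : (μ - ν) + ν = (ν - μ) + μ := by
  rw [← Measure.toSignedMeasure_eq_toSignedMeasure_iff, Measure.toSignedMeasure_add,
    Measure.toSignedMeasure_add]
  have := Measure.sub_toSignedMeasure_eq_toSignedMeasure_sub (μ := μ) (ν := ν)
  rw [sub_eq_sub_iff_add_eq_add] at this
  rw [add_comm (ν - μ).toSignedMeasure]
  exact this.symm

/-- Passing to the Jordan parts discards only mass common to `μ` and `ν`, which cancels in the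
difference. Test functions can thus be evaluated on the original measures. -/
lemma integral_pos_sub_integral_neg {h : I × I → ℝ} (hm : Measurable h) {C : ℝ}
    (hb : ∀ p, |h p| ≤ C) :
    ∫ p, h p ∂(μ - ν) - ∫ p, h p ∂(ν - μ) = ∫ p, h p ∂μ - ∫ p, h p ∂ν := by
  have hi : ∀ (ρ : Measure (I × I)) [IsFiniteMeasure ρ], Integrable h ρ := fun ρ _ =>
    Integrable.of_bound hm.aestronglyMeasurable C (Eventually.of_forall hb)
  have h1 : ∫ p, h p ∂((μ - ν) + ν) = ∫ p, h p ∂((ν - μ) + μ) := by rw [sub_add_eq_sub_add]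
  rw [integral_add_measure (hi _) (hi _), integral_add_measure (hi _) (hi _)] at h1
  linarith

end JordanSub

/-! ### Disintegrations -/

/-- Puts the fibre measures in `norm1` on the same footing as the arbitrary disintegrations allowed
in `measureVar`. -/
lemma isDisintegration_condKernel {μ : Measure (I × I)} [IsFiniteMeasure μ]
    (h : μ.fst ≪ volume) :
    IsDisintegration μ μ.condKernel (density μ) := by
  refine ⟨inferInstance, (Measure.measurable_rnDeriv _ _).ennreal_toNNReal, ?_⟩
  have h1 : (volume.withDensity fun γ => (density μ γ : ℝ≥0∞)) = μ.fst := by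
    have : μ.fst.HaveLebesgueDecomposition volume :=
      Measure.haveLebesgueDecomposition_of_sigmaFinite _ _
    conv_rhs => rw [← Measure.withDensity_rnDeriv_eq _ _ h]
    refine withDensity_congr_ae ?_
    filter_upwards [Measure.rnDeriv_lt_top μ.fst volume] with γ hγ
    exact ENNReal.coe_toNNReal hγ.ne
  rw [h1, Measure.disintegrate]

namespace IsDisintegration

variable {μ : Measure (I × I)} [IsFiniteMeasure μ] {κ : Kernel I I} {φ : I → ℝ≥0}

lemma fst_eq (hd : IsDisintegration μ κ φ) :
    μ.fst = volume.withDensity fun γ => (φ γ : ℝ≥0∞) := by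
  obtain ⟨_, hφ, rfl⟩ := hd
  exact Measure.fst_compProd _ _

lemma lintegral_density (hd : IsDisintegration μ κ φ) : ∫⁻ γ, (φ γ : ℝ≥0∞) = μ univ := by
  have h := congrArg (fun ρ : Measure I => ρ univ) hd.fst_eq
  simpa [Measure.fst_univ] using h.symm

lemma integrable_density (hd : IsDisintegration μ κ φ) : Integrable fun γ => (φ γ : ℝ) := by
  refine ⟨hd.2.1.coe_nnreal_real.aestronglyMeasurable, ?_⟩
  rw [HasFiniteIntegral]
  simp [enorm_eq_nnnorm, hd.lintegral_density]

/-- The integral of `h` along the leaf over `γ` with respect to `φ(γ) κ_γ`. -/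
lemma integral_eq (hd : IsDisintegration μ κ φ) {h : I × I → ℝ} (hm : Measurable h) {C : ℝ}
    (hb : ∀ p, |h p| ≤ C) :
    ∫ p, h p ∂μ = ∫ γ, ∫ y, h (γ, y) ∂(φ γ • κ γ) := by
  obtain ⟨hκ, hφ, hμ⟩ := id hd
  have hi : Integrable h μ :=
    Integrable.of_bound hm.aestronglyMeasurable C (Eventually.of_forall hb)
  rw [hμ] at hi
  conv_lhs => rw [hμ]
  rw [Measure.integral_compProd hi, integral_withDensity_eq_integral_smul hφ]
  simp_rw [integral_smul_nnreal_measure]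

omit [IsFiniteMeasure μ] in
lemma measurable_integral (hd : IsDisintegration μ κ φ) {h : I × I → ℝ} (hm : Measurable h) :
    Measurable fun γ => ∫ y, h (γ, y) ∂(φ γ • κ γ) := by
  obtain ⟨hκ, hφ, hμ⟩ := hd
  simp_rw [integral_smul_nnreal_measure]
  refine hφ.smul ?_
  exact (StronglyMeasurable.integral_kernel_prod_right (κ := κ) (f := fun x y => h (x, y))
    hm.stronglyMeasurable).measurable

omit [IsFiniteMeasure μ] in
lemma abs_integral_le (hd : IsDisintegration μ κ φ) {g : I → ℝ} {C : ℝ}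
    (hb : ∀ y, |g y| ≤ C) (γ : I) : |∫ y, g y ∂(φ γ • κ γ)| ≤ C * φ γ := by
  have := hd.1
  have h := norm_integral_le_of_norm_le_const (μ := φ γ • κ γ) (f := g) (C := C)
    (Eventually.of_forall hb)
  simpa [Measure.real] using h

lemma integrable_integral (hd : IsDisintegration μ κ φ) {h : I × I → ℝ} (hm : Measurable h)
    {C : ℝ} (hb : ∀ p, |h p| ≤ C) : Integrable fun γ => ∫ y, h (γ, y) ∂(φ γ • κ γ) :=
  (hd.integrable_density.const_mul C).mono' (hd.measurable_integral hm).aestronglyMeasurable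
    (Eventually.of_forall fun γ => hd.abs_integral_le (fun y => hb (γ, y)) γ)

end IsDisintegration

/-! ### Duality for the strong-weak norm -/

/-- A test function for `‖·‖₁`: measurable on the square, with `Lip ≤ 1` along the leaves and
bounded by `1`. -/
structure IsTest (h : I × I → ℝ) : Prop where
  meas : Measurable h
  lip : ∀ x, LipschitzWith 1 fun y => h (x, y)
  bdd : ∀ p, |h p| ≤ 1

lemma le_wDist (μ ν : Measure I) {g : I → ℝ} (hg : LipschitzWith 1 g) (hb : ∀ y, |g y| ≤ 1) :
    ENNReal.ofReal |∫ y, g y ∂μ - ∫ y, g y ∂ν| ≤ wDist μ ν :=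
  le_iSup₂_of_le (f := fun (g : I → ℝ)
    (_ : g ∈ {g : I → ℝ | LipschitzWith 1 g ∧ ∀ y, |g y| ≤ 1}) =>
      ENNReal.ofReal |∫ y, g y ∂μ - ∫ y, g y ∂ν|) g ⟨hg, hb⟩ le_rfl

/-- `wDist` is computed by a fixed countable family of test functions. -/
lemma exists_seq_wDist : ∃ g : ℕ → I → ℝ,
    (∀ n, LipschitzWith 1 (g n) ∧ ∀ y, |g n y| ≤ 1) ∧
    ∀ (μ ν : Measure I) [IsFiniteMeasure μ] [IsFiniteMeasure ν],
      wDist μ ν = ⨆ n, ENNReal.ofReal |∫ y, g n y ∂μ - ∫ y, g n y ∂ν| := by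
  -- `C(I, ℝ)` is separable, hence so is `S`; a dense sequence suffices because integration against
  -- a finite measure is continuous on `S`.
  let S : Set C(I, ℝ) := {g | LipschitzWith 1 g ∧ ∀ y, |g y| ≤ 1}
  have : Nonempty S := ⟨⟨0, LipschitzWith.const' 0, by simp⟩⟩
  refine ⟨fun n => (TopologicalSpace.denseSeq S n : C(I, ℝ)),
    fun n => (TopologicalSpace.denseSeq S n).2, fun μ ν _ _ => le_antisymm ?_ ?_⟩
  · refine iSup₂_le fun g hg => ?_
    have hc : ∀ (ρ : Measure I) [IsFiniteMeasure ρ],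
        Continuous fun f : S => ∫ y, (f : C(I, ℝ)) y ∂ρ := by
      intro ρ _
      refine continuous_of_dominated (bound := fun _ => 1) ?_ ?_ (integrable_const _) ?_
      · exact fun f => f.1.continuous.aestronglyMeasurable
      · exact fun f => Eventually.of_forall f.2.2
      · exact Eventually.of_forall fun y =>
          (ContinuousEvalConst.continuous_eval_const y).comp continuous_subtype_val
    let L : S → ℝ≥0∞ := fun f =>
      ENNReal.ofReal |∫ y, (f : C(I, ℝ)) y ∂μ - ∫ y, (f : C(I, ℝ)) y ∂ν|
    have hcl : IsClosed {f : S | L f ≤ ⨆ n, L (TopologicalSpace.denseSeq S n)} :=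
      isClosed_le (ENNReal.continuous_ofReal.comp ((hc μ).sub (hc ν)).abs) continuous_const
    have hr : range (TopologicalSpace.denseSeq S) ⊆
        {f : S | L f ≤ ⨆ n, L (TopologicalSpace.denseSeq S n)} :=
      range_subset_iff.2 fun n => le_iSup (fun n => L (TopologicalSpace.denseSeq S n)) n
    exact closure_minimal hr hcl
      (TopologicalSpace.denseRange_denseSeq S (⟨⟨g, hg.1.continuous⟩, hg⟩ : S))
  · exact iSup_le fun n => le_wDist μ ν (TopologicalSpace.denseSeq S n).2.1
      (TopologicalSpace.denseSeq S n).2.2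

section Duality

variable {μ₁ μ₂ : Measure (I × I)} [IsFiniteMeasure μ₁] [IsFiniteMeasure μ₂]
  {κ₁ κ₂ : Kernel I I} {φ₁ φ₂ : I → ℝ≥0}

omit [IsFiniteMeasure μ₁] [IsFiniteMeasure μ₂] in
/-- Finitely many fibrewise test functions are dominated by one measurable choice. -/
lemma exists_isTest_dominating (h₁ : IsDisintegration μ₁ κ₁ φ₁) (h₂ : IsDisintegration μ₂ κ₂ φ₂)
    {g : ℕ → I → ℝ} (hg : ∀ n, LipschitzWith 1 (g n) ∧ ∀ y, |g n y| ≤ 1) (N : ℕ) :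
    ∃ h : I × I → ℝ, IsTest h ∧ ∀ n < N, ∀ γ,
      |∫ y, g n y ∂(φ₁ γ • κ₁ γ) - ∫ y, g n y ∂(φ₂ γ • κ₂ γ)| ≤
        ∫ y, h (γ, y) ∂(φ₁ γ • κ₁ γ) - ∫ y, h (γ, y) ∂(φ₂ γ • κ₂ γ) := by
  classical
  induction N with
  | zero => exact ⟨fun _ => 0, ⟨measurable_const, fun _ => LipschitzWith.const' 0, by simp⟩,
      fun n hn => absurd hn (Nat.not_lt_zero n)⟩
  | succ N ih =>
    obtain ⟨h, ht, hle⟩ := ih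
    set v : (I × I → ℝ) → I → ℝ := fun h γ =>
      ∫ y, h (γ, y) ∂(φ₁ γ • κ₁ γ) - ∫ y, h (γ, y) ∂(φ₂ γ • κ₂ γ) with hv
    have hvm : ∀ {h : I × I → ℝ}, Measurable h → Measurable (v h) := fun hm =>
      (h₁.measurable_integral hm).sub (h₂.measurable_integral hm)
    have hgm : Measurable fun p : I × I => g N p.2 :=
      (hg N).1.continuous.measurable.comp measurable_snd
    set d : I → ℝ := v fun p => g N p.2 with hd
    have hdm : Measurable d := hvm hgm
    have hA : MeasurableSet {γ | |d γ| ≤ v h γ} :=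
      measurableSet_le hdm.abs (hvm ht.meas)
    have hB : MeasurableSet {γ | 0 ≤ d γ} := measurableSet_le measurable_const hdm
    -- Keep `h` where it already does at least as well as `g N`; elsewhere take `g N` with the sign
    -- of `d`. The choice depends on the leaf only, so the Lipschitz bound along leaves survives.
    let h' : I × I → ℝ := fun p => if p.1 ∈ {γ | |d γ| ≤ v h γ} then h p else
      if p.1 ∈ {γ | 0 ≤ d γ} then g N p.2 else - g N p.2
    have key : ∀ γ, |d γ| ≤ v h' γ ∧ v h γ ≤ v h' γ := by
      intro γ
      by_cases h1 : |d γ| ≤ v h γ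
      · have e : ∀ y, h' (γ, y) = h (γ, y) := fun y => if_pos h1
        have e : v h' γ = v h γ := by simp only [hv, e]
        exact ⟨e ▸ h1, e.ge⟩
      · have e : v h' γ = |d γ| := by
          by_cases h2 : 0 ≤ d γ
          · have e : ∀ y, h' (γ, y) = g N y := fun y => (if_neg h1).trans (if_pos h2)
            rw [abs_of_nonneg h2]
            simp only [hv, e, hd]
          · have e : ∀ y, h' (γ, y) = -g N y := fun y => (if_neg h1).trans (if_neg h2)
            rw [abs_of_neg (not_le.1 h2)]
            simp only [hv, e, integral_neg, hd]
            ring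
        exact ⟨e.ge, by rw [e]; exact (not_le.1 h1).le⟩
    refine ⟨h', ⟨?_, ?_, ?_⟩, ?_⟩
    · exact Measurable.ite (measurable_fst hA) ht.meas
        (Measurable.ite (measurable_fst hB) hgm hgm.neg)
    · intro x
      by_cases h1 : |d x| ≤ v h x
      · simpa [h', h1] using ht.lip x
      · by_cases h2 : 0 ≤ d x
        · simpa [h', h1, h2] using (hg N).1
        · simp only [h', mem_ofPred_eq, h1, h2, if_false]
          exact LipschitzWith.of_dist_le_mul fun y z => by
            simpa [dist_neg_neg] using (hg N).1.dist_le_mul y z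
    · intro p
      by_cases h1 : |d p.1| ≤ v h p.1
      · simpa [h', h1] using ht.bdd p
      · by_cases h2 : 0 ≤ d p.1
        · simpa [h', h1, h2] using (hg N).2 p.2
        · simpa [h', h1, h2] using (hg N).2 p.2
    · intro n hn γ
      rcases Nat.lt_succ_iff_lt_or_eq.1 hn with hn | rfl
      · exact (hle n hn γ).trans (key γ).2
      · exact (key γ).1

/-- Duality: the `L¹` norm of the fibrewise Wasserstein distance is controlled by the action on
test functions. -/
lemma lintegral_wDist_le (h₁ : IsDisintegration μ₁ κ₁ φ₁) (h₂ : IsDisintegration μ₂ κ₂ φ₂)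
    {B : ℝ} (hB : ∀ h, IsTest h → ∫ p, h p ∂μ₁ - ∫ p, h p ∂μ₂ ≤ B) :
    ∫⁻ γ, wDist (φ₁ γ • κ₁ γ) (φ₂ γ • κ₂ γ) ≤ ENNReal.ofReal B := by
  obtain ⟨g, hg, hw⟩ := exists_seq_wDist
  have := h₁.1
  have := h₂.1
  set d : ℕ → I → ℝ := fun n γ => ∫ y, g n y ∂(φ₁ γ • κ₁ γ) - ∫ y, g n y ∂(φ₂ γ • κ₂ γ) with hd
  have hdm : ∀ n, Measurable fun γ => ENNReal.ofReal |d n γ| := fun n => by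
    have hgm : Measurable fun p : I × I => g n p.2 :=
      (hg n).1.continuous.measurable.comp measurable_snd
    exact ((h₁.measurable_integral hgm).sub (h₂.measurable_integral hgm)).abs.ennreal_ofReal
  -- An increasing limit of finite suprema, ready for monotone convergence.
  have e : ∀ γ, wDist (φ₁ γ • κ₁ γ) (φ₂ γ • κ₂ γ) =
      ⨆ N : ℕ, (⨆ n ∈ Iio N, ENNReal.ofReal |d n γ|) := by
    intro γ
    rw [hw]
    refine le_antisymm (iSup_le fun n => ?_) (iSup_le fun N => iSup₂_le fun n _ => ?_)
    · exact le_iSup_of_le (n + 1)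
        (le_iSup₂_of_le (f := fun n (_ : n ∈ Iio _) => ENNReal.ofReal |d n γ|) n
          (Nat.lt_succ_self n) le_rfl)
    · exact le_iSup (fun n => ENNReal.ofReal |d n γ|) n
  simp_rw [e]
  rw [lintegral_iSup (fun N => Measurable.biSup (Iio N) (to_countable _) fun n _ => hdm n)]
  · refine iSup_le fun N => ?_
    -- `N + 1` rather than `N`: the index 0 is then always included, which makes `v` nonnegative.
    obtain ⟨h, ht, hle⟩ := exists_isTest_dominating h₁ h₂ hg (N + 1)
    set v : I → ℝ := fun γ =>
      ∫ y, h (γ, y) ∂(φ₁ γ • κ₁ γ) - ∫ y, h (γ, y) ∂(φ₂ γ • κ₂ γ) with hv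
    have hi₁ := h₁.integrable_integral ht.meas ht.bdd
    have hi₂ := h₂.integrable_integral ht.meas ht.bdd
    have hv0 : ∀ γ, 0 ≤ v γ := fun γ => (abs_nonneg _).trans (hle 0 (Nat.succ_pos N) γ)
    calc _ ≤ ∫⁻ γ, ENNReal.ofReal (v γ) := lintegral_mono fun γ => iSup₂_le fun n hn =>
          ENNReal.ofReal_le_ofReal (hle n ((mem_Iio.1 hn).trans (Nat.lt_succ_self N)) γ)
      _ = ENNReal.ofReal (∫ γ, v γ) :=
          (ofReal_integral_eq_lintegral_ofReal (hi₁.sub hi₂) (Eventually.of_forall hv0)).symm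
      _ ≤ ENNReal.ofReal B := by
          refine ENNReal.ofReal_le_ofReal ?_
          rw [hv, integral_sub hi₁ hi₂, ← h₁.integral_eq ht.meas ht.bdd,
            ← h₂.integral_eq ht.meas ht.bdd]
          exact hB h ht
  · intro N N' hN γ
    exact biSup_mono fun n hn => lt_of_lt_of_le hn hN

/-- Duality for `‖μ₁ - μ₂‖₁`. -/
lemma isL1_sub_and_norm1_sub_le (h₁ : μ₁.fst ≪ volume) (h₂ : μ₂.fst ≪ volume) {B : ℝ}
    (hB : ∀ h, IsTest h → ∫ p, h p ∂μ₁ - ∫ p, h p ∂μ₂ ≤ B) :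
    IsL1 (μ₁.toSignedMeasure - μ₂.toSignedMeasure) ∧
      norm1 (μ₁.toSignedMeasure - μ₂.toSignedMeasure) ≤ ENNReal.ofReal B := by
  have hp : (pos (μ₁.toSignedMeasure - μ₂.toSignedMeasure)).fst ≪ volume := by
    rw [pos_sub]
    exact (Measure.absolutelyContinuous_of_le
      (Measure.map_mono Measure.sub_le measurable_fst)).trans h₁
  have hn : (neg (μ₁.toSignedMeasure - μ₂.toSignedMeasure)).fst ≪ volume := by
    rw [neg_sub]
    exact (Measure.absolutelyContinuous_of_le
      (Measure.map_mono Measure.sub_le measurable_fst)).trans h₂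
  have key : norm1 (μ₁.toSignedMeasure - μ₂.toSignedMeasure) ≤ ENNReal.ofReal B := by
    refine lintegral_wDist_le (isDisintegration_condKernel hp) (isDisintegration_condKernel hn) ?_
    intro h ht
    rw [pos_sub, neg_sub, integral_pos_sub_integral_neg ht.meas ht.bdd]
    exact hB h ht
  exact ⟨⟨⟨hp, hn⟩, key.trans_lt ENNReal.ofReal_lt_top⟩, key⟩

end Duality

end LorenzStability

namespace LorenzStability

/-! ### Variation of paths of measures -/

/-- The integration functional of a measure on the test functions defining `wDist`, as an element
of a space of functions with the uniform distance. -/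
noncomputable def testFunctional (μ : Measure I) :
    UniformFun {g : I → ℝ | LipschitzWith 1 g ∧ ∀ y, |g y| ≤ 1} ℝ :=
  UniformFun.ofFun fun g => ∫ y, g.1 y ∂μ

lemma edist_testFunctional (μ ν : Measure I) :
    edist (testFunctional μ) (testFunctional ν) = wDist μ ν := by
  rw [UniformFun.edist_def, wDist, iSup_subtype']
  refine iSup_congr fun g => ?_
  rw [edist_dist, Real.dist_eq]
  rfl

/-- Gives access to monotonicity and to superadditivity over adjacent sets for `eVariationOn`. -/
lemma pathVar_eq_eVariationOn (Γ : I → Measure I) (D : Set I) :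
    pathVar Γ D = eVariationOn (fun x => testFunctional (Γ x)) D := by
  simp only [pathVar, eVariationOn, edist_testFunctional, iSup_prod, iSup_subtype]

lemma pathVar_mono (Γ : I → Measure I) {D D' : Set I} (h : D ⊆ D') :
    pathVar Γ D ≤ pathVar Γ D' := by
  simp only [pathVar_eq_eVariationOn]
  exact eVariationOn.mono _ h

lemma wDist_le_pathVar (Γ : I → Measure I) {D : Set I} {x y : I} (hx : x ∈ D) (hy : y ∈ D) :
    wDist (Γ x) (Γ y) ≤ pathVar Γ D := by
  rw [pathVar_eq_eVariationOn, ← edist_testFunctional]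
  exact eVariationOn.edist_le (fun x => testFunctional (Γ x)) hx hy

lemma wDist_comm (μ ν : Measure I) : wDist μ ν = wDist ν μ := by
  simp only [← edist_testFunctional, edist_comm]

/-- A path of bounded variation is dominated by a bounded monotone function. -/
lemma exists_monotone_of_pathVar_le {Γ : I → Measure I} {D : Set I} {M : ℝ≥0}
    (hM : pathVar Γ D ≤ M) :
    ∃ V : ℝ → ℝ, Monotone V ∧ (∀ t, 0 ≤ V t ∧ V t ≤ M) ∧
      ∀ x ∈ D, ∀ y ∈ D, wDist (Γ x) (Γ y) ≤ ENNReal.ofReal |V x - V y| := by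
  set f : I → _ := fun x => testFunctional (Γ x) with hf
  -- The variation accumulated up to `t`. Real `t` allows evaluation at `x ± ε` outside the unit
  -- interval.
  set W : ℝ → ℝ≥0∞ := fun t => eVariationOn f (D ∩ {x | (x : ℝ) ≤ t}) with hW
  have hWM : ∀ t, W t ≤ M := fun t =>
    (eVariationOn.mono f inter_subset_left).trans ((pathVar_eq_eVariationOn Γ D) ▸ hM)
  have hWt : ∀ t, W t ≠ ∞ := fun t => ((hWM t).trans_lt ENNReal.coe_lt_top).ne
  have hmono : Monotone W := fun t t' h =>
    eVariationOn.mono f (inter_subset_inter_right _ fun x (hx : (x : ℝ) ≤ t) => hx.trans h)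
  have key : ∀ x ∈ D, ∀ y ∈ D, x ≤ y →
      wDist (Γ x) (Γ y) ≤ ENNReal.ofReal |(W x).toReal - (W y).toReal| := by
    intro x hx y hy hxy
    have h1 : W x + edist (f x) (f y) ≤ W y := by
      calc W x + edist (f x) (f y) ≤ W x + eVariationOn f {x, y} := by
            gcongr
            exact eVariationOn.edist_le f (by simp) (by simp)
        _ ≤ eVariationOn f ((D ∩ {z | (z : ℝ) ≤ x}) ∪ {x, y}) := by
            refine eVariationOn.add_le_union f ?_
            rintro z ⟨_, hz⟩ w (rfl | rfl)
            · exact hz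
            · exact le_trans (show z ≤ x from hz) hxy
        _ ≤ W y := by
            refine eVariationOn.mono f (union_subset ?_ ?_)
            · exact inter_subset_inter_right _ fun z (hz : (z : ℝ) ≤ x) => hz.trans hxy
            · rintro w (rfl | rfl)
              · exact ⟨hx, hxy⟩
              · exact ⟨hy, le_refl (w : ℝ)⟩
    rw [abs_sub_comm, ← edist_testFunctional]
    refine le_trans ?_ (ENNReal.ofReal_le_ofReal (le_abs_self _))
    rw [ENNReal.ofReal_sub _ ENNReal.toReal_nonneg, ENNReal.ofReal_toReal (hWt _),
      ENNReal.ofReal_toReal (hWt _)]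
    exact ENNReal.le_sub_of_add_le_left (hWt _) h1
  refine ⟨fun t => (W t).toReal, fun t t' h => ENNReal.toReal_mono (hWt _) (hmono h),
    fun t => ⟨ENNReal.toReal_nonneg, ENNReal.toReal_le_coe_of_le_coe (hWM t)⟩, fun x hx y hy => ?_⟩
  rcases le_total x y with h | h
  · exact key x hx y hy h
  · rw [wDist_comm, abs_sub_comm]
    exact key y hy x hx h

/-! ### Integrals over the unit interval -/

lemma integral_unitInterval (f : ℝ → ℝ) : ∫ x : I, f x = ∫ x in (0 : ℝ)..1, f x := by
  rw [intervalIntegral.integral_of_le zero_le_one, ← integral_Icc_eq_integral_Ioc]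
  exact integral_subtype_comap measurableSet_Icc f

/-- The two shifted integrals cancel except on windows of length `2ε` around 1 and around 0. The
first contributes at most `2εM`; the second enters with a minus sign and is nonnegative before it.
-/
lemma integral_monotone_shift_sub_le {V : ℝ → ℝ} (hV : Monotone V) {M : ℝ}
    (hb : ∀ t, 0 ≤ V t ∧ V t ≤ M) {ε : ℝ} (hε : 0 ≤ ε) :
    ∫ x : I, (V (x + ε) - V (x - ε)) ≤ 2 * ε * M := by
  have hi : ∀ a b : ℝ, IntervalIntegrable V volume a b := fun a b => hV.intervalIntegrable
  rw [integral_unitInterval fun x => V (x + ε) - V (x - ε)]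
  rw [intervalIntegral.integral_sub, intervalIntegral.integral_comp_add_right,
    intervalIntegral.integral_comp_sub_right,
    ← intervalIntegral.integral_interval_sub_interval_comm' (hi _ _) (hi _ _) (hi _ _)]
  rotate_left
  · exact (hV.comp fun a b h => by gcongr : Monotone fun x => V (x + ε)).intervalIntegrable
  · exact (hV.comp fun a b h => by gcongr : Monotone fun x => V (x - ε)).intervalIntegrable
  have h1 : ∫ x in (1 - ε)..(1 + ε), V x ≤ 2 * ε * M := by
    calc _ ≤ ∫ _ in (1 - ε)..(1 + ε), M :=
          intervalIntegral.integral_mono_on (by linarith) (hi _ _)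
            intervalIntegrable_const fun x _ => (hb x).2
      _ = 2 * ε * M := by rw [intervalIntegral.integral_const, smul_eq_mul]; ring
  have h2 : 0 ≤ ∫ x in (0 - ε)..(0 + ε), V x :=
    intervalIntegral.integral_nonneg (by linarith) fun x _ => (hb x).1
  linarith

lemma integrable_monotone_shift_sub {V : ℝ → ℝ} (hV : Monotone V) {M : ℝ}
    (hb : ∀ t, 0 ≤ V t ∧ V t ≤ M) (ε : ℝ) :
    Integrable fun x : I => V (x + ε) - V (x - ε) := by
  refine Integrable.of_bound (C := M) ?_ (Eventually.of_forall fun x => ?_)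
  · exact ((hV.measurable.comp (measurable_subtype_coe.add_const ε)).sub
      (hV.measurable.comp (measurable_subtype_coe.sub_const ε))).aestronglyMeasurable
  · rw [Real.norm_eq_abs, abs_le]
    constructor <;> linarith [(hb (x + ε)).1, (hb (x + ε)).2, (hb (x - ε)).1, (hb (x - ε)).2]

/-! ### Change of variables under a diffeomorphism -/

lemma lineExt_coe (h : I → I) (x : I) : lineExt h x = h x := by
  simp [lineExt]

lemma continuous_of_contDiffOn_lineExt {h : I → I} (hh : ContDiffOn ℝ 1 (lineExt h) (Icc 0 1)) :
    Continuous h := by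
  refine Continuous.subtype_mk (p := (· ∈ I)) (f := fun x => (h x : ℝ)) ?_ (fun x => (h x).2)
  have := continuousOn_iff_continuous_domRestrict.1 hh.continuousOn
  exact this.congr fun x => lineExt_coe h x

lemma setIntegral_unitInterval {A : Set I} (f : ℝ → ℝ) :
    ∫ x in A, f x = ∫ x in Subtype.val '' A, f x := by
  rw [← (unitInterval.measurePreserving_coe).setIntegral_image_emb
    (MeasurableEmbedding.subtype_coe measurableSet_Icc) f A, Measure.restrict_restrict_of_subset]
  rintro _ ⟨x, _, rfl⟩
  exact x.2

namespace IsDiffeo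

variable {s : I ≃ I}

lemma measurableSet_image (hs : IsDiffeo s) {A : Set I} (hA : MeasurableSet A) :
    MeasurableSet (s '' A) := by
  rw [Equiv.image_eq_preimage_symm]
  exact (continuous_of_contDiffOn_lineExt hs.2).measurable hA

lemma measurable (hs : IsDiffeo s) : Measurable s :=
  (continuous_of_contDiffOn_lineExt hs.1).measurable

lemma setIntegral_image (hs : IsDiffeo s) {A : Set I} (hA : MeasurableSet A) (k : I → ℝ) :
    ∫ u in s '' A, k u =
      ∫ x in A, |derivWithin (lineExt s) (Icc 0 1) x| * k (s x) := by
  set K : ℝ → ℝ := fun u => k (projIcc 0 1 zero_le_one u) with hK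
  have hKc : ∀ u : I, K u = k u := fun u => by simp [hK]
  have himg : (Subtype.val '' (s '' A) : Set ℝ) = lineExt s '' (Subtype.val '' A) := by
    simp only [image_image, lineExt_coe]
  have h1 := setIntegral_unitInterval (A := s '' A) K
  have h2 := setIntegral_unitInterval (A := A)
    fun x => |derivWithin (lineExt s) (Icc 0 1) x| * K (lineExt s x)
  simp only [hKc, lineExt_coe] at h1 h2
  rw [h1, h2, himg]
  refine integral_image_eq_integral_abs_deriv_smul
    ((MeasurableEmbedding.subtype_coe measurableSet_Icc).measurableSet_image.2 hA) ?_ ?_ _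
  · rintro _ ⟨x, _, rfl⟩
    refine (((hs.1.differentiableOn one_ne_zero) x x.2).hasDerivWithinAt).mono ?_
    rintro _ ⟨y, _, rfl⟩
    exact y.2
  · rintro _ ⟨x, _, rfl⟩ _ ⟨y, _, rfl⟩ hxy
    rw [lineExt_coe, lineExt_coe] at hxy
    exact congrArg _ (s.injective (Subtype.ext hxy))

lemma measurable_derivWithin (hs : IsDiffeo s) :
    Measurable fun x : I => derivWithin (lineExt s) (Icc 0 1) x :=
  (continuousOn_iff_continuous_domRestrict.1 (hs.1.continuousOn_derivWithin
    (uniqueDiffOn_Icc zero_lt_one) le_rfl)).measurable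

/-- Where `|1/s' - 1| ≤ ε`, the derivative is close to `1`. -/
lemma abs_deriv_bounds {t ε : ℝ} (hε : 0 ≤ ε) (hε' : ε ≤ 1 / 2) (h : |1 / t - 1| ≤ ε) :
    1 - ε ≤ |t| ∧ |(1 - |t|)| ≤ 2 * ε := by
  -- For `t ≤ 0`, including the default value `1 / 0 = 0`, one has `|1/t - 1| ≥ 1 > ε`.
  have ht : 0 < t := by
    by_contra hn
    have : 1 / t ≤ 0 := div_nonpos_of_nonneg_of_nonpos zero_le_one (not_lt.1 hn)
    rw [abs_le] at h
    linarith [h.1]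
  rw [abs_of_pos ht]
  rw [abs_le] at h
  have h3 : t * (1 / t) = 1 := mul_one_div_cancel ht.ne'
  have h1 : 1 ≤ t * (1 + ε) := by nlinarith
  have h2 : t * (1 - ε) ≤ 1 := by nlinarith
  have h4 : 1 - ε ≤ t := by nlinarith
  exact ⟨h4, abs_le.2 ⟨by nlinarith, by nlinarith⟩⟩

section Estimates

variable {A : Set I} {ε : ℝ}

lemma measureReal_image_ge (hs : IsDiffeo s) (hA : MeasurableSet A) (hε : 0 ≤ ε) (hε' : ε ≤ 1 / 2)
    (h : ∀ x ∈ A, |1 / derivWithin (lineExt s) (Icc 0 1) x - 1| ≤ ε) :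
    (1 - ε) * volume.real A ≤ volume.real (s '' A) := by
  have h1 := hs.setIntegral_image hA fun _ => 1
  simp only [mul_one, integral_const, smul_eq_mul, measureReal_restrict_apply_univ] at h1
  rw [h1, mul_comm, ← smul_eq_mul, ← setIntegral_const]
  refine setIntegral_mono_on (by simp) ?_ hA fun x hx => (abs_deriv_bounds hε hε' (h x hx)).1
  refine Measure.integrableOn_of_bounded (M := 2) (measure_ne_top _ _)
    hs.measurable_derivWithin.abs.aestronglyMeasurable ?_
  filter_upwards [ae_restrict_mem hA] with x hx
  have := (abs_le.1 (abs_deriv_bounds hε hε' (h x hx)).2).1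
  rw [Real.norm_eq_abs, abs_abs]
  linarith

/-- On `A` the Jacobian differs from 1 by at most `2ε`, a loss of `2εK`. What `s '' A` misses has
measure at most `ε + volume.real Aᶜ`, a loss of `K` times that. -/
lemma setIntegral_comp_sub_integral_le (hs : IsDiffeo s) (hA : MeasurableSet A) (hε : 0 ≤ ε)
    (hε' : ε ≤ 1 / 2) (h : ∀ x ∈ A, |1 / derivWithin (lineExt s) (Icc 0 1) x - 1| ≤ ε)
    {k : I → ℝ} (hk : Measurable k) {K : ℝ} (hK : 0 ≤ K) (hkK : ∀ᵐ x, |k x| ≤ K)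
    (hkA : ∀ x ∈ A, |k (s x)| ≤ K) :
    (∫ x in A, k (s x)) - ∫ x, k x ≤ K * (3 * ε + volume.real Aᶜ) := by
  have hsA := hs.measurableSet_image hA
  have hki : Integrable k := Integrable.of_bound hk.aestronglyMeasurable K hkK
  have hkc : Measurable fun x => k (s x) := hk.comp hs.measurable
  have e1 : ∫ x, k x = (∫ x in s '' A, k x) + ∫ x in (s '' A)ᶜ, k x :=
    (integral_add_compl hsA hki).symm
  have i1 : IntegrableOn (fun x => k (s x)) A :=
    Measure.integrableOn_of_bounded (measure_ne_top _ _) hkc.aestronglyMeasurable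
      ((ae_restrict_mem hA).mono fun x hx => hkA x hx)
  have i2 : IntegrableOn (fun x : I => |derivWithin (lineExt s) (Icc 0 1) x| * k (s x)) A := by
    refine Measure.integrableOn_of_bounded (M := 2 * K) (measure_ne_top _ _)
      (hs.measurable_derivWithin.abs.mul hkc).aestronglyMeasurable
      ((ae_restrict_mem hA).mono fun x hx => ?_)
    have := (abs_le.1 (abs_deriv_bounds hε hε' (h x hx)).2).1
    rw [norm_mul, Real.norm_eq_abs, abs_abs, Real.norm_eq_abs]
    exact mul_le_mul (by linarith) (hkA x hx) (abs_nonneg _) zero_le_two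
  have e2 : (∫ x in A, k (s x)) - ∫ x in s '' A, k x ≤ 2 * ε * K := by
    rw [hs.setIntegral_image hA, ← integral_sub i1 i2]
    have hb : ∀ x ∈ A, ‖k (s x) - |derivWithin (lineExt s) (Icc 0 1) x| * k (s x)‖ ≤
        2 * ε * K := by
      intro x hx
      rw [← one_sub_mul, norm_mul]
      exact mul_le_mul (abs_deriv_bounds hε hε' (h x hx)).2 (hkA x hx) (abs_nonneg _) (by linarith)
    refine (le_abs_self _).trans ((norm_setIntegral_le_of_norm_le_const
      (measure_lt_top _ _) hb).trans ?_)
    exact mul_le_of_le_one_right (by positivity) measureReal_le_one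
  have e3 : |∫ x in (s '' A)ᶜ, k x| ≤ K * volume.real (s '' A)ᶜ :=
    norm_setIntegral_le_of_norm_le_const_ae (f := k) (measure_lt_top _ _) (ae_restrict_of_ae hkK)
  have e4 : volume.real (s '' A)ᶜ ≤ ε + volume.real Aᶜ := by
    have := hs.measureReal_image_ge hA hε hε' h
    have hA1 : volume.real A ≤ 1 := measureReal_le_one
    rw [probReal_compl_eq_one_sub hsA, probReal_compl_eq_one_sub hA]
    nlinarith
  have e5 := mul_le_mul_of_nonneg_left e4 hK
  rw [e1]
  linarith [neg_abs_le (∫ x in (s '' A)ᶜ, k x)]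

end Estimates

end IsDiffeo

end LorenzStability

namespace LorenzStability

/-! ### Partitions -/

namespace IsPartition

variable {q : ℕ} {a : Fin (q + 1) → ℝ}

lemma exists_mem_cell (ha : IsPartition q a) {x : ℝ} (hx : x ∈ Icc (0 : ℝ) 1)
    (hxa : ∀ j, x ≠ a j) : ∃ i, x ∈ cell a i := by
  by_contra! hn
  have hlt : ∀ j, a j < x := by
    intro j
    induction j using Fin.induction with
    | zero => exact lt_of_le_of_ne (ha.first ▸ hx.1) (hxa 0).symm
    | succ i ih =>
      by_contra hi
      exact hn i ⟨ih, lt_of_le_of_ne (not_lt.1 hi) (hxa _)⟩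
  have := hlt (Fin.last q)
  rw [ha.last] at this
  exact absurd hx.2 (not_le.2 this)

lemma exists_mem_cell_of_far (ha : IsPartition q a) {x z ε : ℝ} (hx : x ∈ Icc (0 : ℝ) 1)
    (hε : 0 ≤ ε) (hxa : ∀ j, ε < |x - a j|) (hz : |z - x| ≤ ε) :
    ∃ i, x ∈ cell a i ∧ z ∈ cell a i := by
  obtain ⟨i, hi⟩ := ha.exists_mem_cell hx fun j hj => by
    have := hxa j
    rw [hj, sub_self, abs_zero] at this
    exact absurd hε (not_le.2 this)
  have h1 := hxa i.castSucc
  have h2 := hxa i.succ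
  rw [abs_of_pos (sub_pos.2 hi.1)] at h1
  rw [abs_of_neg (sub_neg.2 hi.2)] at h2
  rw [abs_le] at hz
  exact ⟨i, hi, by linarith, by linarith⟩

end IsPartition

lemma measureReal_near_le {n : ℕ} (a : Fin n → ℝ) {ε : ℝ} (hε : 0 ≤ ε) :
    volume.real {x : I | ∃ j, |(x : ℝ) - a j| ≤ ε} ≤ n * (2 * ε) := by
  have h1 : {x : I | ∃ j, |(x : ℝ) - a j| ≤ ε} = ⋃ j, {x : I | |(x : ℝ) - a j| ≤ ε} := by
    ext x; simp
  have h2 : ∀ j, volume {x : I | |(x : ℝ) - a j| ≤ ε} ≤ ENNReal.ofReal (2 * ε) := by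
    intro j
    rw [unitInterval.volume_apply, ← Real.volume_closedBall (a j)]
    refine measure_mono ?_
    rintro _ ⟨x, hx, rfl⟩
    simpa [Real.dist_eq] using hx
  rw [h1]
  refine ENNReal.toReal_le_of_le_ofReal (by positivity) ((measure_iUnion_fintype_le _ _).trans ?_)
  refine (Finset.sum_le_sum fun j _ => h2 j).trans ?_
  rw [Finset.sum_const, Finset.card_univ, Fintype.card_fin, nsmul_eq_mul,
    ENNReal.ofReal_mul (Nat.cast_nonneg n), ENNReal.ofReal_natCast]

/-! ### Nonsingularity of piecewise `C¹` maps -/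

/-- Rolle's theorem makes `t` injective on the interval. By change of variables `|t'|` integrates to
the measure of a subset of `E`, hence to 0, and `t'` does not vanish. -/
lemma volume_inter_preimage_eq_zero {t : ℝ → ℝ} (htm : Measurable t) {u v : ℝ}
    (hd : DifferentiableOn ℝ t (Ioo u v)) (h0 : ∀ x ∈ Ioo u v, deriv t x ≠ 0) {E : Set ℝ}
    (hE : MeasurableSet E) (hE0 : volume E = 0) : volume (Ioo u v ∩ t ⁻¹' E) = 0 := by
  have hBm : MeasurableSet (Ioo u v ∩ t ⁻¹' E) := measurableSet_Ioo.inter (htm hE)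
  have hda : ∀ x ∈ Ioo u v, DifferentiableAt ℝ t x := fun x hx =>
    hd.differentiableAt (isOpen_Ioo.mem_nhds hx)
  have hinj : InjOn t (Ioo u v) := by
    have hlt : ∀ x ∈ Ioo u v, ∀ y ∈ Ioo u v, x < y → t x ≠ t y := by
      intro x hx y hy hxy he
      have hsub : Icc x y ⊆ Ioo u v := fun z hz =>
        ⟨hx.1.trans_le hz.1, hz.2.trans_lt hy.2⟩
      obtain ⟨c, hc, hc0⟩ := exists_deriv_eq_zero hxy (hd.continuousOn.mono hsub) he
      exact h0 c (hsub (Ioo_subset_Icc_self hc)) hc0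
    intro x hx y hy he
    rcases lt_trichotomy x y with h | h | h
    · exact absurd he (hlt x hx y hy h)
    · exact h
    · exact absurd he.symm (hlt y hy x hx h)
  have hcv := lintegral_image_eq_lintegral_abs_deriv_mul hBm
    (fun x hx => (hda x hx.1).hasDerivAt.hasDerivWithinAt) (hinj.mono inter_subset_left) fun _ => 1
  have himg : volume (t '' (Ioo u v ∩ t ⁻¹' E)) = 0 :=
    measure_mono_null (by rintro _ ⟨x, hx, rfl⟩; exact hx.2) hE0
  rw [setLIntegral_measure_zero _ _ himg] at hcv
  simp only [mul_one] at hcv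
  have h3 := (setLIntegral_eq_zero_iff hBm (measurable_deriv t).abs.ennreal_ofReal).1 hcv.symm
  rw [measure_eq_zero_iff_ae_notMem]
  filter_upwards [h3] with x hx hxB
  have := hx hxB
  rw [ENNReal.ofReal_eq_zero] at this
  exact h0 x hxB.1 (abs_nonpos_iff.1 this)

lemma map_absolutelyContinuous {T : I → I} (hT : Measurable T) {q : ℕ} {a : Fin (q + 1) → ℝ}
    (ha : IsPartition q a) (hC : ∀ i, ContDiffOn ℝ 1 (lineExt T) (cell a i))
    (h0 : ∀ i, ∀ x ∈ cell a i, deriv (lineExt T) x ≠ 0) :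
    (volume : Measure I).map T ≪ volume := by
  refine Measure.AbsolutelyContinuous.mk fun E hE hE0 => ?_
  rw [Measure.map_apply hT hE, unitInterval.volume_apply]
  have hemb := MeasurableEmbedding.subtype_coe (measurableSet_Icc (a := (0 : ℝ)) (b := 1))
  have htm : Measurable (lineExt T) :=
    measurable_subtype_coe.comp (hT.comp continuous_projIcc.measurable)
  have hsub : (Subtype.val '' (T ⁻¹' E) : Set ℝ) ⊆
      range a ∪ ⋃ i, cell a i ∩ lineExt T ⁻¹' (Subtype.val '' E) := by
    rintro _ ⟨x, hx, rfl⟩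
    by_cases hxa : (x : ℝ) ∈ range a
    · exact Or.inl hxa
    · obtain ⟨i, hi⟩ := ha.exists_mem_cell x.2 fun j hj => hxa ⟨j, hj.symm⟩
      exact Or.inr (mem_iUnion.2 ⟨i, hi, T x, hx, (lineExt_coe T x).symm⟩)
  refine measure_mono_null hsub (measure_union_null ((finite_range a).measure_zero _)
    (measure_iUnion_null fun i => ?_))
  refine volume_inter_preimage_eq_zero htm ((hC i).differentiableOn one_ne_zero) (h0 i)
    (hemb.measurableSet_image.2 hE) ?_
  rwa [← unitInterval.volume_apply]

lemma fst_map_absolutelyContinuous {A₁ : ℝ} {F : SkewProduct} (hF : IsBVLorenzLike A₁ F)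
    {μ : Measure (I × I)} (hμ : μ.fst ≪ volume) : (μ.map F.map).fst ≪ volume := by
  obtain ⟨⟨q, a, ha, hC, h0, -⟩, -⟩ := hF.expanding
  have : (μ.map F.map).fst = μ.fst.map F.T := by
    rw [Measure.fst, Measure.map_map measurable_fst F.measurable_map, Measure.fst,
      Measure.map_map F.measurable_T measurable_fst]
    rfl
  rw [this]
  exact (hμ.map F.measurable_T).trans (map_absolutelyContinuous F.measurable_T ha hC h0)

/-! ### The comparison of the two transfer operators on test functions -/

section Comparison

variable {μ : Measure (I × I)} [IsProbabilityMeasure μ] {κ : Kernel I I} {φ : I → ℝ≥0} {D : Set I}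
  {M : ℝ≥0}

lemma IsDisintegration.integral_density (hd : IsDisintegration μ κ φ) : ∫ γ, (φ γ : ℝ) = 1 := by
  have h := hd.lintegral_density
  rw [measure_univ] at h
  rw [integral_eq_lintegral_of_nonneg_ae (Eventually.of_forall fun γ => NNReal.coe_nonneg _)
    hd.2.1.coe_nnreal_real.aestronglyMeasurable]
  simp [h]

/-- The constant test function 1 shows that the density oscillates by at most `M` on `D`; having
mean 1, it is at most 1 somewhere on `D`. -/
lemma IsDisintegration.density_le (hd : IsDisintegration μ κ φ) (hD : ∀ᵐ γ : I, γ ∈ D)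
    (hM : pathVar (fun γ => φ γ • κ γ) D ≤ M) {x : I} (hx : x ∈ D) : (φ x : ℝ) ≤ M + 1 := by
  have := hd.1
  obtain ⟨y, hy, hy1⟩ := exists_notMem_null_le_integral hd.integrable_density
    (N := Dᶜ) (mem_ae_iff.1 (show D ∈ ae volume from hD))
  rw [hd.integral_density] at hy1
  have h1 : ∀ γ, ∫ _, (1 : ℝ) ∂(φ γ • κ γ) = φ γ := fun γ => by simp [Measure.real]
  have h2 := (le_wDist (φ x • κ x) (φ y • κ y) (g := fun _ => 1) (LipschitzWith.const' 1)
    (by simp)).trans ((wDist_le_pathVar (fun γ => φ γ • κ γ) hx (not_notMem.1 hy)).trans hM)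
  rw [h1, h1, ← ENNReal.ofReal_coe_nnreal] at h2
  have h3 := (ENNReal.ofReal_le_ofReal_iff M.coe_nonneg).1 h2
  linarith [le_abs_self ((φ x : ℝ) - φ y)]

omit [IsProbabilityMeasure μ] in
/-- Pointwise comparison of the fibrewise actions at `x` and at the displaced point `z`. -/
lemma fibre_comparison (hd : IsDisintegration μ κ φ) {F₀ F₁ : SkewProduct} {h : I × I → ℝ}
    (ht : IsTest h) {x z : I} {η w : ℝ} (hT : F₀.T x = F₁.T z)
    (hG : ∀ y, |(F₀.G x y : ℝ) - F₁.G z y| ≤ η)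
    (hc : ∀ y₁ y₂, |(F₁.G z y₁ : ℝ) - F₁.G z y₂| ≤ |(y₁ : ℝ) - y₂|) (hw : 0 ≤ w)
    (hW : wDist (φ x • κ x) (φ z • κ z) ≤ ENNReal.ofReal w) :
    (∫ y, h (F₀.map (x, y)) ∂(φ x • κ x)) - ∫ y, h (F₁.map (z, y)) ∂(φ z • κ z) ≤
      η * φ x + w := by
  have := hd.1
  have hi : ∀ (F : SkewProduct) (v : I), Integrable (fun y => h (F.map (v, y))) (φ x • κ x) :=
    fun F v => Integrable.of_bound ((ht.meas.comp F.measurable_map).comp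
      measurable_prodMk_left).aestronglyMeasurable 1 (Eventually.of_forall fun y => ht.bdd _)
  -- First the map is changed while the measure stays over `x`; both images lie on the leaf over
  -- `F₁.T z`.
  have h1 := hd.abs_integral_le (g := fun y => h (F₀.map (x, y)) - h (F₁.map (z, y))) (C := η)
    (fun y => by
      have := (ht.lip (F₁.T z)).dist_le_mul (F₀.G x y) (F₁.G z y)
      simp only [SkewProduct.map, hT]
      rw [Real.dist_eq, NNReal.coe_one, one_mul, Subtype.dist_eq, Real.dist_eq] at this
      exact this.trans (hG y)) x
  rw [integral_sub (hi F₀ x) (hi F₁ z)] at h1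
  -- Then the measure is changed. Fibre contraction of `F₁` makes this integrand admissible in
  -- `wDist`.
  have hlip : LipschitzWith 1 fun y => h (F₁.map (z, y)) :=
    LipschitzWith.of_dist_le_mul fun y₁ y₂ => by
      refine ((ht.lip (F₁.T z)).dist_le_mul (F₁.G z y₁) (F₁.G z y₂)).trans ?_
      rw [NNReal.coe_one, one_mul, one_mul, Subtype.dist_eq, Real.dist_eq, Subtype.dist_eq,
        Real.dist_eq]
      exact hc y₁ y₂
  have h2 := (le_wDist (φ x • κ x) (φ z • κ z) hlip fun y => ht.bdd _).trans hW
  rw [ENNReal.ofReal_le_ofReal_iff hw] at h2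
  linarith [(abs_le.1 h1).2, (abs_le.1 h2).2]

lemma integral_test_sub_le (hd : IsDisintegration μ κ φ) (hDm : MeasurableSet D)
    (hD : ∀ᵐ γ : I, γ ∈ D) (hM : pathVar (fun γ => φ γ • κ γ) D ≤ M) {F₀ F₁ : SkewProduct}
    {H : ℝ} (hH : 0 ≤ H) {d : ℕ} {b : Fin (d + 1) → ℝ} (hb : IsPartition d b)
    (hHb : ∀ i, ∀ x₁ x₂ y : I, (x₁ : ℝ) ∈ cell b i → (x₂ : ℝ) ∈ cell b i →
      |(F₀.G x₁ y : ℝ) - F₀.G x₂ y| ≤ H * |(x₁ : ℝ) - x₂|)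
    (hc : ∀ x y₁ y₂ : I, |(F₁.G x y₁ : ℝ) - F₁.G x y₂| ≤ |(y₁ : ℝ) - y₂|)
    {ε δ : ℝ} (hε : 0 ≤ ε) (hε' : ε ≤ 1 / 2) (hδ : 0 ≤ δ) (hεδ : ε ≤ 2 * δ)
    {A : Set I} (hA : MeasurableSet A) (hAε : 1 - ε ≤ volume.real A) {s : I ≃ I} (hs : IsDiffeo s)
    (hAs : ∀ x ∈ A, F₀.T x = F₁.T (s x) ∧ |(s x : ℝ) - x| ≤ ε ∧
      |1 / derivWithin (lineExt s) (Icc 0 1) x - 1| ≤ ε)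
    {A' : Set I} (hA' : MeasurableSet A') (hA'δ : 1 - δ ≤ volume.real A')
    (hA'G : ∀ x ∈ A', ∀ y : I, |(F₀.G x y : ℝ) - F₁.G x y| ≤ δ)
    {h : I × I → ℝ} (ht : IsTest h) :
    ∫ p, h (F₀.map p) ∂μ - ∫ p, h (F₁.map p) ∂μ ≤ (8 * d + 27 + 2 * H) * δ * (M + 1) := by
  obtain ⟨V, hV, hVM, hVw⟩ := exists_monotone_of_pathVar_le hM
  have hm : ∀ F : SkewProduct, Measurable fun p => h (F.map p) := fun F =>
    ht.meas.comp F.measurable_map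
  set k : SkewProduct → I → ℝ := fun F x => ∫ y, h (F.map (x, y)) ∂(φ x • κ x) with hk
  have hkm : ∀ F, Measurable (k F) := fun F => hd.measurable_integral (hm F)
  have hki : ∀ F, Integrable (k F) := fun F => hd.integrable_integral (hm F) fun p => ht.bdd _
  have hkD : ∀ F, ∀ x ∈ D, |k F x| ≤ M + 1 := fun F x hx =>
    (hd.abs_integral_le (C := 1) (fun y => ht.bdd _) x).trans
      (by rw [one_mul]; exact hd.density_le hD hM hx)
  have hkae : ∀ F, ∀ᵐ x, |k F x| ≤ M + 1 := fun F => hD.mono (hkD F)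
  have hM0 : (0 : ℝ) ≤ M := M.2
  -- exceptional sets of the base
  set N : Set I := {x : I | ∃ j, |(x : ℝ) - b j| ≤ ε} with hN
  have hNm : MeasurableSet N := by
    have : N = ⋃ j, {x : I | |(x : ℝ) - b j| ≤ ε} := by ext x; simp [hN]
    rw [this]
    exact MeasurableSet.iUnion fun j =>
      measurableSet_le (measurable_subtype_coe.sub_const _).abs measurable_const
  -- The density bound and the closeness of the fibre maps are needed at `s x`, not at `x`. Since
  -- `s` shrinks measure on `A` by a factor of at least `1 - ε ≥ 1/2`, the set `R` has measure at
  -- most `2δ`.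
  set R : Set I := A ∩ s ⁻¹' (D ∩ A')ᶜ with hR
  have hRm : MeasurableSet R := hA.inter (hs.measurable (hDm.inter hA').compl)
  set Q : Set I := (A ∩ D) ∩ (Rᶜ ∩ Nᶜ) with hQ
  have hQm : MeasurableSet Q := (hA.inter hDm).inter (hRm.compl.inter hNm.compl)
  have hD0 : volume.real Dᶜ = 0 := by
    rw [measureReal_def, mem_ae_iff.1 (show D ∈ ae volume from hD), ENNReal.toReal_zero]
  have hRδ : volume.real R ≤ 2 * δ := by
    have h1 := hs.measureReal_image_ge hRm hε hε' fun x hx => (hAs x hx.1).2.2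
    have h2 : volume.real (s '' R) ≤ volume.real Dᶜ + volume.real A'ᶜ := by
      refine (measureReal_mono ?_).trans (measureReal_union_le _ _)
      rintro _ ⟨x, hx, rfl⟩
      rw [← compl_inter]
      exact hx.2
    rw [hD0, probReal_compl_eq_one_sub hA'] at h2
    nlinarith [measureReal_nonneg (μ := volume) (s := R)]
  have hQc : volume.real Qᶜ ≤ (4 * d + 8) * δ := by
    have h1 : Qᶜ ⊆ (Aᶜ ∪ Dᶜ) ∪ (R ∪ N) := by
      rw [hQ, compl_inter, compl_inter, compl_inter, compl_compl, compl_compl]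
    have h2 := (measureReal_mono (μ := volume) h1).trans
      ((measureReal_union_le _ _).trans
        (add_le_add (measureReal_union_le _ _) (measureReal_union_le _ _)))
    rw [hD0, probReal_compl_eq_one_sub hA] at h2
    have h3 := measureReal_near_le b hε
    rw [← hN] at h3
    push_cast at h3
    have h4 : ((d : ℝ) + 1) * (2 * ε) ≤ (d + 1) * (2 * (2 * δ)) := by gcongr
    linarith
  have hQs : ∀ x ∈ Q, s x ∈ D ∩ A' := fun x hx => by
    by_contra hn
    exact hx.2.1 ⟨hx.1.1, hn⟩
  -- the pointwise comparison on the good set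
  have hpt : ∀ x ∈ Q, k F₀ x - k F₁ (s x) ≤ (H * ε + δ) * φ x + (V (x + ε) - V (x - ε)) := by
    intro x hx
    obtain ⟨hT, hsx, -⟩ := hAs x hx.1.1
    obtain ⟨i, hi, hi'⟩ := hb.exists_mem_cell_of_far x.2 hε
      (fun j => not_le.1 fun hj => hx.2.2 ⟨j, hj⟩) hsx
    have hsx' := abs_le.1 hsx
    -- A majorant free of `s`, so it can be integrated over the base.
    have hVx : |V x - V (s x)| ≤ V (x + ε) - V (x - ε) := by
      have h1 : V (x - ε) ≤ V x := hV (by linarith)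
      have h2 : V x ≤ V (x + ε) := hV (by linarith)
      have h3 : V (x - ε) ≤ V (s x) := hV (by linarith)
      have h4 : V (s x) ≤ V (x + ε) := hV (by linarith)
      exact abs_le.2 ⟨by linarith, by linarith⟩
    refine fibre_comparison hd ht hT (fun y => ?_) (hc _)
      ((abs_nonneg _).trans hVx)
      ((hVw x hx.1.2 _ (hQs x hx).1).trans (ENNReal.ofReal_le_ofReal hVx))
    have h1 := hHb i x (s x) y hi hi'
    rw [abs_sub_comm (x : ℝ)] at h1
    have h2 := mul_le_mul_of_nonneg_left hsx hH
    exact (abs_sub_le _ (F₀.G (s x) y : ℝ) _).trans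
      (add_le_add (h1.trans h2) (hA'G _ (hQs x hx).2 y))
  -- integration
  have hcomp : IntegrableOn (fun x => k F₁ (s x)) Q :=
    Measure.integrableOn_of_bounded (M := (M : ℝ) + 1) (measure_ne_top _ _)
      ((hkm F₁).comp hs.measurable).aestronglyMeasurable
      ((ae_restrict_mem hQm).mono fun x hx => hkD F₁ _ (hQs x hx).1)
  have hmaj : Integrable fun x : I => (H * ε + δ) * (φ x : ℝ) + (V (x + ε) - V (x - ε)) :=
    (hd.integrable_density.const_mul _).add (integrable_monotone_shift_sub hV hVM ε)
  have e1 : (∫ x in Q, k F₀ x) - ∫ x in Q, k F₁ (s x) ≤ (H * ε + δ) + 2 * ε * M := by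
    rw [← integral_sub (hki F₀).integrableOn hcomp]
    calc _ ≤ ∫ x in Q, ((H * ε + δ) * (φ x : ℝ) + (V (x + ε) - V (x - ε))) :=
          setIntegral_mono_on ((hki F₀).integrableOn.sub hcomp) hmaj.integrableOn hQm hpt
      _ ≤ ∫ x : I, ((H * ε + δ) * (φ x : ℝ) + (V (x + ε) - V (x - ε))) := by
          refine setIntegral_le_integral hmaj (Eventually.of_forall fun x => ?_)
          exact add_nonneg (by positivity) (sub_nonneg.2 (hV (by linarith)))
      _ ≤ _ := by
          rw [integral_add (hd.integrable_density.const_mul _)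
            (integrable_monotone_shift_sub hV hVM ε), integral_const_mul, hd.integral_density,
            mul_one]
          gcongr
          exact integral_monotone_shift_sub_le hV hVM hε
  have e2 := hs.setIntegral_comp_sub_integral_le hQm hε hε' (fun x hx => (hAs x hx.1.1).2.2)
    (hkm F₁) (by positivity) (hkae F₁) (fun x hx => hkD F₁ _ (hQs x hx).1)
  have e3 : |∫ x in Qᶜ, k F₀ x| ≤ (M + 1) * volume.real Qᶜ :=
    norm_setIntegral_le_of_norm_le_const_ae (f := k F₀) (measure_lt_top _ _)
      (ae_restrict_of_ae (hkae F₀))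
  rw [hd.integral_eq (hm F₀) (fun p => ht.bdd _), hd.integral_eq (hm F₁) (fun p => ht.bdd _)]
  change (∫ x, k F₀ x) - ∫ x, k F₁ x ≤ _
  rw [← integral_add_compl hQm (hki F₀)]
  -- With `ε ≤ 2δ`, in units of `δ(M+1)`: `2(4d+8)` from `Qᶜ` counted twice, 6 from the change of
  -- variables, `2H+1` from the maps and 4 from the variation.
  have e4 := mul_le_mul_of_nonneg_left hQc (show (0 : ℝ) ≤ M + 1 by positivity)
  have e5 : (M + 1 : ℝ) * ε ≤ (M + 1) * (2 * δ) := by gcongr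
  have e6 : H * ε ≤ H * (2 * δ) := by gcongr
  have e7 : 0 ≤ (H * (2 * δ) + δ) * (M : ℝ) := by positivity
  nlinarith [le_abs_self (∫ x in Qᶜ, k F₀ x)]

end Comparison

end LorenzStability

/-! ### Near-optimal choices and the conclusion -/

namespace LorenzStability

/-- The infimum need not be attained. The set is nonempty (`ε = 1`, empty `A`, identity), which
rules out the default value of `sInf ∅`. -/
lemma exists_mem_skorokhodSet_lt {T₁ T₂ : I → I} {c : ℝ} (h : skorokhodDist T₁ T₂ < c) :
    ∃ ε ∈ skorokhodSet T₁ T₂, 0 ≤ ε ∧ ε < c := by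
  have hid : IsDiffeo (Equiv.refl I) := by
    have : ContDiffOn ℝ 1 (lineExt (Equiv.refl I)) (Icc 0 1) :=
      contDiffOn_id.congr fun x hx => by simp [lineExt, projIcc_of_mem _ hx]
    exact ⟨this, this⟩
  have hne : (skorokhodSet T₁ T₂).Nonempty :=
    ⟨1, ∅, Equiv.refl I, MeasurableSet.empty, hid, by simp, fun x hx => absurd hx (notMem_empty x)⟩
  obtain ⟨ε, hε, hεc⟩ := exists_lt_of_csInf_lt hne h
  refine ⟨ε, hε, ?_, hεc⟩
  obtain ⟨A, -, -, -, hA, -⟩ := hε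
  linarith [measureReal_le_one (μ := (volume : Measure I)) (s := A)]

lemma transfer_toSignedMeasure (F : SkewProduct) (μ : Measure (I × I)) [IsFiniteMeasure μ] :
    F.transfer μ.toSignedMeasure = (μ.map F.map).toSignedMeasure := by
  ext E hE
  rw [F.transfer_apply _ hE, Measure.toSignedMeasure_apply_measurable hE,
    Measure.toSignedMeasure_apply_measurable (F.measurable_map hE),
    map_measureReal_apply F.measurable_map hE]

/-- A measure of small variation has a disintegration of small variation on a measurable set of
full measure. -/
lemma exists_disintegration_of_measureVar_lt {μ : Measure (I × I)} {M : ℝ≥0∞}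
    (h : measureVar μ < M) : ∃ (κ : Kernel I I) (φ : I → ℝ≥0) (D : Set I),
      IsDisintegration μ κ φ ∧ MeasurableSet D ∧ (∀ᵐ γ : I, γ ∈ D) ∧
        pathVar (fun γ => φ γ • κ γ) D ≤ M := by
  simp only [measureVar, iInf_lt_iff] at h
  obtain ⟨κ, φ, D, ⟨hd, hD⟩, hlt⟩ := h
  have hsub : (toMeasurable volume Dᶜ)ᶜ ⊆ D := compl_subset_comm.1 (subset_toMeasurable _ _)
  refine ⟨κ, φ, _, hd, (measurableSet_toMeasurable volume Dᶜ).compl, ?_,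
    (pathVar_mono _ hsub).trans hlt.le⟩
  have hD0 : volume Dᶜ = 0 := mem_ae_iff.1 (show D ∈ ae volume from hD)
  exact compl_mem_ae_iff.2 ((measure_toMeasurable _).trans hD0)

end LorenzStability

theorem proposition8p5
    (A₁ : ℝ) (hA₁ : 0 < A₁)
    (F : ℝ → LorenzStability.SkewProduct)
    (hF : ∀ δ ∈ Set.Ico (0 : ℝ) 1, LorenzStability.IsBVLorenzLike A₁ (F δ))
    (h2 : LorenzStability.UBV2 F)
    (h3 : LorenzStability.UBV3 F) :
    ∃ C₁ : ℝ, 0 < C₁ ∧ ∃ δ₁ ∈ Set.Ioc (0 : ℝ) 1,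
      ∀ (f : ℝ → ProbabilityMeasure (I × I)) (M₂ : ℝ≥0),
        (∀ δ ∈ Set.Ico (0 : ℝ) 1,
          LorenzStability.IsBVInf11 A₁ (f δ : Measure (I × I)).toSignedMeasure ∧
          (F δ).transfer (f δ : Measure (I × I)).toSignedMeasure =
            (f δ : Measure (I × I)).toSignedMeasure ∧
          LorenzStability.measureVar (f δ : Measure (I × I)) ≤ (M₂ : ℝ≥0∞)) →
        ∀ δ ∈ Set.Ico (0 : ℝ) δ₁,
          LorenzStability.IsL1
            ((F 0).transfer (f δ : Measure (I × I)).toSignedMeasure -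
              (F δ).transfer (f δ : Measure (I × I)).toSignedMeasure) ∧
          LorenzStability.norm1
            ((F 0).transfer (f δ : Measure (I × I)).toSignedMeasure -
              (F δ).transfer (f δ : Measure (I × I)).toSignedMeasure) ≤
            ENNReal.ofReal (C₁ * δ * ((M₂ : ℝ) + 1)) := by
  obtain ⟨d2, hd2, hsk⟩ := h2
  obtain ⟨d3, hd3, hG⟩ := h3
  have hF0 := hF 0 ⟨le_rfl, one_pos⟩
  obtain ⟨H, d, b, hH, hb, hHb⟩ := hF0.lipschitz
  -- `H` and `d` belong to `F 0` alone. The factor 2 absorbs `M₂ + 2 ≤ 2(M₂ + 1)`, the variation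
  -- bound being relaxed to `M₂ + 1` to pick a disintegration; `1/4` ensures `ε < 2δ ≤ 1/2`.
  refine ⟨2 * (8 * d + 27 + 2 * H), by positivity, min (1 / 4) (min d2 d3),
    ⟨lt_min (by norm_num) (lt_min hd2.1 hd3.1), (min_le_left _ _).trans (by norm_num)⟩, ?_⟩
  intro f M₂ hf δ hδ
  have hδ4 : δ < 1 / 4 := hδ.2.trans_le (min_le_left _ _)
  have hδ2 : δ < d2 := hδ.2.trans_le ((min_le_right _ _).trans (min_le_left _ _))
  have hδ3 : δ < d3 := hδ.2.trans_le ((min_le_right _ _).trans (min_le_right _ _))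
  have hδ1 : δ ∈ Set.Ico (0 : ℝ) 1 := ⟨hδ.1, by linarith⟩
  obtain ⟨-, -, hvar⟩ := hf δ hδ1
  set μ : Measure (I × I) := (f δ : Measure (I × I)) with hμ
  obtain ⟨κ, φ, D, hdis, hDm, hD, hpv⟩ := LorenzStability.exists_disintegration_of_measureVar_lt
    (μ := μ) (M := ((M₂ + 1 : ℝ≥0) : ℝ≥0∞))
    (hvar.trans_lt (ENNReal.coe_lt_coe.2 (lt_add_of_pos_right _ one_pos)))
  have hac : μ.fst ≪ volume := by
    rw [hdis.fst_eq]
    exact withDensity_absolutelyContinuous _ _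
  have hFδ := hF δ hδ1
  have : ∀ F : LorenzStability.SkewProduct, IsProbabilityMeasure (μ.map F.map) := fun F =>
    Measure.isProbabilityMeasure_map F.measurable_map.aemeasurable
  rw [LorenzStability.transfer_toSignedMeasure, LorenzStability.transfer_toSignedMeasure]
  refine LorenzStability.isL1_sub_and_norm1_sub_le (LorenzStability.fst_map_absolutelyContinuous hF0 hac)
    (LorenzStability.fst_map_absolutelyContinuous hFδ hac) fun h ht => ?_
  rw [integral_map (F 0).measurable_map.aemeasurable ht.meas.aestronglyMeasurable,
    integral_map (F δ).measurable_map.aemeasurable ht.meas.aestronglyMeasurable]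
  have hM0 : (0 : ℝ) ≤ M₂ := M₂.2
  -- At `δ = 0` there is no room for `ε < 2δ`, but the two maps coincide.
  rcases hδ.1.eq_or_lt with rfl | hpos
  · rw [sub_self]
    simp
  obtain ⟨ε, ⟨A, s, hA, hs, hAε, hAs⟩, hε, hεδ⟩ :=
    LorenzStability.exists_mem_skorokhodSet_lt (c := 2 * δ) ((hsk δ ⟨hδ.1, hδ2⟩).trans_lt (by linarith))
  obtain ⟨A', hA', hA'δ, hA'G⟩ := hG δ ⟨hδ.1, hδ3⟩
  obtain ⟨α, hα, hαG⟩ := hFδ.contracting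
  refine (LorenzStability.integral_test_sub_le hdis hDm hD hpv hH hb hHb (fun x y₁ y₂ => (hαG x y₁ y₂).trans
    (mul_le_of_le_one_left (abs_nonneg _) hα.2.le)) hε (by linarith) hδ.1 hεδ.le hA hAε hs hAs
    hA' hA'δ hA'G ht).trans ?_
  push_cast
  have : 0 ≤ (8 * d + 27 + 2 * H) * δ * (M₂ : ℝ) := by positivity
  linarith
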